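/- Let $(\Omega,P)$ be a probability space carrying an outcome $Y$ (real-valued), a treatment $A$, covariates $X$, a negative control outcome $W$, an unmeasured confounder $U$ ($W$ and $U$ with values in standard Borel spaces) and a tie indicator $S\in\{0,1\}$ with $P(S=1)>0$. All laws below are conditional on $S=1$. Fix a regular conditional law of $(Y,W,U)$ given $(A,X)=(a,x)$; write $F(w\mid a,x)$, $F(u\mid a,x)$, $F(w,u\mid a,x)$ for its marginals, and compute the conditional expectations $E(\cdot\mid a,u,x)$ and $E(\cdot\mid w,a,x)$ under it. Let $T$ be a set of values $(a,x)$ (for instance, all $(a,x)$ with $a$ in the support of $A$). Assume that for every $(a,x)\in T$: 1. (Completeness of $W$ for $U$) if $f\in L^2\{F(u\mid a,x)\}$ and $E\{f(U)\mid W=w,A=a,X=x\}=0$ for $F(w\mid a,x)$-almost all $w$, then $f=0$ $F(u\mid a,x)$-almost everywhere. 2. (Regularity) (a) $F(w,u\mid a,x)$ is absolutely continuous with respect to $F(w\mid a,x)\otimes F(u\mid a,x)$, and its density $K(w,u,a,x)=\dfrac{dF(w,u\mid a,x)}{dF(w\mid a,x)\,dF(u\mid a,x)}$ satisfies $\iint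 K(w,u,a,x)^2\,dF(w\mid a,x)\,dF(u\mid a,x)<\infty$; (b) $E(Y\mid a,u,x)$ exists for $F(u\mid a,x)$-almost all $u$ and $\int E(Y\mid a,u,x)^2\,dF(u\mid a,x)<\infty$; (c) $\displaystyle\sum_{p}\frac{1}{\nu_{a,x,p}^2}\bigl|\langle E(Y\mid a,\cdot,x),\kappa_{a,x,p}\rangle\bigr|^2<\infty$ (inner product of $L^2\{F(u\mid a,x)\}$), where $(\nu_{a,x,p},\upsilon_{a,x,p},\kappa_{a,x,p})_p$ is a (finite or infinite) singular system, with $\nu_{a,x,p}>0$, of the operator $K_{a,x}:L^2\{F(w\mid a,x)\}\to L^2\{F(u\mid a,x)\}$, $(K_{a,x}g)(u)=\int K(w,u,a,x)g(w)\,dF(w\mid a,x)$ (the value of the sum does not depend on the choice of the singular system). Then there is a measurable function $h(w,a,x)$ such that for every $(a,x)\in T$ we have $h(\cdot,a,x)\in L^2\{F(w\mid a,x)\}$ and $$E(Y\mid A=a,U=u,X=x,S=1)=E\{h(W,a,x)\mid A=a,U=u,X=x,S=1\}\quad\text{for } F(u\mid a,x)\text{-almost all }u .$$ -/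

import Mathlib

open MeasureTheory ProbabilityTheory
open scoped ENNReal

noncomputable section

namespace ConfoundingBridge

section IntegralOperator

variable {𝒲 𝒰 : Type*} [MeasurableSpace 𝒲] [MeasurableSpace 𝒰]
  {p : Measure 𝒲} {q : Measure 𝒰} [IsFiniteMeasure p] [IsFiniteMeasure q]

/-- The function `u ↦ ∫ k(w, u) h(w) dp(w)`. -/
def kernelIntegral (p : Measure 𝒲) (k : 𝒲 × 𝒰 → ℝ) (h : 𝒲 → ℝ) : 𝒰 → ℝ :=
  fun u => ∫ w, k (w, u) * h w ∂p

lemma eLpNorm_two_eq {α : Type*} [MeasurableSpace α] (μ : Measure α) (f : α → ℝ) :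
    eLpNorm f 2 μ = (∫⁻ x, ‖f x‖ₑ ^ (2 : ℝ) ∂μ) ^ (1 / (2 : ℝ)) := by
  rw [eLpNorm_eq_lintegral_rpow_enorm_toReal two_ne_zero ENNReal.ofNat_ne_top]
  simp

lemma eLpNorm_kernelIntegral_le {k : 𝒲 × 𝒰 → ℝ} (hk : AEStronglyMeasurable k (p.prod q))
    {h : 𝒲 → ℝ} (hh : AEStronglyMeasurable h p) :
    eLpNorm (kernelIntegral p k h) 2 q ≤ eLpNorm k 2 (p.prod q) * eLpNorm h 2 p := by
  have hconj : (2 : ℝ).HolderConjugate 2 := by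
    rw [Real.holderConjugate_iff]; norm_num
  have key : ∀ᵐ u ∂q, ‖kernelIntegral p k h u‖ₑ ^ (2 : ℝ) ≤
      (∫⁻ w, ‖k (w, u)‖ₑ ^ (2 : ℝ) ∂p) * ∫⁻ w, ‖h w‖ₑ ^ (2 : ℝ) ∂p := by
    filter_upwards [hk.prodMk_right] with u hu
    have h1 : ‖kernelIntegral p k h u‖ₑ ≤
        (∫⁻ w, ‖k (w, u)‖ₑ ^ (2 : ℝ) ∂p) ^ (1 / (2 : ℝ)) *
          (∫⁻ w, ‖h w‖ₑ ^ (2 : ℝ) ∂p) ^ (1 / (2 : ℝ)) := by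
      refine (enorm_integral_le_lintegral_enorm _).trans ?_
      simp_rw [enorm_mul]
      exact ENNReal.lintegral_mul_le_Lp_mul_Lq p hconj hu.enorm hh.enorm
    refine (ENNReal.rpow_le_rpow h1 (by norm_num : (0 : ℝ) ≤ 2)).trans ?_
    rw [ENNReal.mul_rpow_of_nonneg _ _ (by norm_num), ← ENNReal.rpow_mul, ← ENNReal.rpow_mul]
    norm_num
  rw [eLpNorm_two_eq, eLpNorm_two_eq, eLpNorm_two_eq, ← ENNReal.mul_rpow_of_nonneg _ _ (by norm_num)]
  refine ENNReal.rpow_le_rpow ?_ (by norm_num)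
  have hm : AEMeasurable (fun u => ∫⁻ w, ‖k (w, u)‖ₑ ^ (2 : ℝ) ∂p) q :=
    (hk.enorm.pow_const (2 : ℝ)).prod_swap.lintegral_prod_right'
  rw [lintegral_prod_symm _ (hk.enorm.pow_const _), ← lintegral_mul_const'' _ hm]
  exact lintegral_mono_ae key

lemma memLp_kernelIntegral {k : 𝒲 × 𝒰 → ℝ} (hk : MemLp k 2 (p.prod q))
    {h : 𝒲 → ℝ} (hh : MemLp h 2 p) : MemLp (kernelIntegral p k h) 2 q := by
  refine ⟨?_, (eLpNorm_kernelIntegral_le hk.1 hh.1).trans_lt (ENNReal.mul_lt_top hk.2 hh.2)⟩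
  exact (hk.1.mul hh.1.comp_fst).prod_swap.integral_prod_right'

lemma ae_integrable_kernel_mul {k : 𝒲 × 𝒰 → ℝ} (hk : MemLp k 2 (p.prod q))
    {h : 𝒲 → ℝ} (hh : MemLp h 2 p) : ∀ᵐ u ∂q, Integrable (fun w => k (w, u) * h w) p := by
  have h1 : MemLp (fun z : 𝒲 × 𝒰 => h z.1) 2 (p.prod q) := hh.comp_fst q
  exact (hk.integrable_mul h1).prod_left_ae

/-- The linear map underlying `integralOperator`. -/
def integralLinearMap (k : 𝒲 × 𝒰 → ℝ) (hk : MemLp k 2 (p.prod q)) : Lp ℝ 2 p →ₗ[ℝ] Lp ℝ 2 q where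
  toFun h := (memLp_kernelIntegral hk (Lp.memLp h)).toLp (kernelIntegral p k h)
  map_add' := by
    intro f g
    rw [← MemLp.toLp_add]
    refine MemLp.toLp_congr _ _ ?_
    filter_upwards [ae_integrable_kernel_mul hk (Lp.memLp f),
      ae_integrable_kernel_mul hk (Lp.memLp g)] with u hf hg
    simp only [kernelIntegral, Pi.add_apply]
    rw [← integral_add hf hg]
    refine integral_congr_ae ?_
    filter_upwards [Lp.coeFn_add f g] with w hw
    rw [hw, Pi.add_apply, mul_add]
  map_smul' := by
    intro c f
    rw [RingHom.id_apply, ← MemLp.toLp_const_smul]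
    refine MemLp.toLp_congr _ _ (Filter.Eventually.of_forall fun u => ?_)
    simp only [kernelIntegral, Pi.smul_apply, smul_eq_mul]
    rw [← integral_const_mul]
    refine integral_congr_ae ?_
    filter_upwards [Lp.coeFn_smul c f] with w hw
    rw [hw, Pi.smul_apply, smul_eq_mul]
    ring

lemma norm_integralLinearMap_le (k : 𝒲 × 𝒰 → ℝ) (hk : MemLp k 2 (p.prod q)) (f : Lp ℝ 2 p) :
    ‖integralLinearMap k hk f‖ ≤ (eLpNorm k 2 (p.prod q)).toReal * ‖f‖ := by
  have h1 : ‖integralLinearMap k hk f‖ = (eLpNorm (kernelIntegral p k f) 2 q).toReal :=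
    Lp.norm_toLp _ (memLp_kernelIntegral hk (Lp.memLp f))
  rw [h1, Lp.norm_def, ← ENNReal.toReal_mul]
  exact ENNReal.toReal_mono (ENNReal.mul_lt_top hk.2 (Lp.memLp f).2).ne
    (eLpNorm_kernelIntegral_le hk.1 (Lp.memLp f).1)

/-- The integral operator `h ↦ ∫ k(w, ·) h(w) dp(w)` from `L²(p)` to `L²(q)` given by a kernel `k`
that is square integrable for `p ⊗ q`. -/
def integralOperator (k : 𝒲 × 𝒰 → ℝ) (hk : MemLp k 2 (p.prod q)) : Lp ℝ 2 p →L[ℝ] Lp ℝ 2 q :=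
  (integralLinearMap k hk).mkContinuous (eLpNorm k 2 (p.prod q)).toReal
    (norm_integralLinearMap_le k hk)

end IntegralOperator

/-- `(ν, υ, κ)` is a singular system of the operator `K`: positive singular values `ν i` and
orthonormal families `υ`, `κ` with `K υᵢ = νᵢ κᵢ`, `K* κᵢ = νᵢ υᵢ` and
`K h = ∑ᵢ νᵢ ⟨υᵢ, h⟩ κᵢ` for every `h`. The index set may be finite (operators of finite rank). -/
structure IsSingularSystem {E F : Type*} [NormedAddCommGroup E] [InnerProductSpace ℝ E]
    [CompleteSpace E] [NormedAddCommGroup F] [InnerProductSpace ℝ F] [CompleteSpace F]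
    (K : E →L[ℝ] F) {ι : Type} (ν : ι → ℝ) (υ : ι → E) (κ : ι → F) : Prop where
  pos : ∀ i, 0 < ν i
  orthonormal_left : Orthonormal ℝ υ
  orthonormal_right : Orthonormal ℝ κ
  map_left : ∀ i, K (υ i) = ν i • κ i
  map_right : ∀ i, K.adjoint (κ i) = ν i • υ i
  expansion : ∀ h : E, HasSum (fun i => (ν i * inner ℝ (υ i) h) • κ i) (K h)

section Fibre

/-! Below, `Q` is a probability measure on `ℝ × 𝒲 × 𝒰`: the conditional law of `(Y, W, U)` given
`A = a` and `X = x`. -/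

variable {𝒲 𝒰 : Type*} [MeasurableSpace 𝒲] [MeasurableSpace 𝒰]

/-- `F(w | a, x)`. -/
def lawW (Q : Measure (ℝ × 𝒲 × 𝒰)) : Measure 𝒲 := Q.map (fun z => z.2.1)

/-- `F(u | a, x)`. -/
def lawU (Q : Measure (ℝ × 𝒲 × 𝒰)) : Measure 𝒰 := Q.map (fun z => z.2.2)

/-- `F(w, u | a, x)`. -/
def lawWU (Q : Measure (ℝ × 𝒲 × 𝒰)) : Measure (𝒲 × 𝒰) := Q.map (fun z => z.2)

instance (Q : Measure (ℝ × 𝒲 × 𝒰)) [IsFiniteMeasure Q] : IsFiniteMeasure (lawW Q) := by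
  unfold lawW; infer_instance

instance (Q : Measure (ℝ × 𝒲 × 𝒰)) [IsFiniteMeasure Q] : IsFiniteMeasure (lawU Q) := by
  unfold lawU; infer_instance

instance (Q : Measure (ℝ × 𝒲 × 𝒰)) [IsFiniteMeasure Q] : IsFiniteMeasure (lawWU Q) := by
  unfold lawWU; infer_instance

/-- The conditional law of `Y` given `A = a, U = u, X = x`. -/
def lawYGivenU (Q : Measure (ℝ × 𝒲 × 𝒰)) [IsFiniteMeasure Q] : Kernel 𝒰 ℝ :=
  condDistrib (fun z => z.1) (fun z => z.2.2) Q

/-- The conditional law of `W` given `A = a, U = u, X = x`. -/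
def lawWGivenU [StandardBorelSpace 𝒲] [Nonempty 𝒲] (Q : Measure (ℝ × 𝒲 × 𝒰))
    [IsFiniteMeasure Q] : Kernel 𝒰 𝒲 :=
  condDistrib (fun z => z.2.1) (fun z => z.2.2) Q

/-- The conditional law of `U` given `W = w, A = a, X = x`. -/
def lawUGivenW [StandardBorelSpace 𝒰] [Nonempty 𝒰] (Q : Measure (ℝ × 𝒲 × 𝒰))
    [IsFiniteMeasure Q] : Kernel 𝒲 𝒰 :=
  condDistrib (fun z => z.2.2) (fun z => z.2.1) Q

/-- `u ↦ E(Y | a, u, x)`. -/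
def outcomeMean (Q : Measure (ℝ × 𝒲 × 𝒰)) [IsFiniteMeasure Q] : 𝒰 → ℝ :=
  fun u => ∫ y, y ∂(lawYGivenU Q u)

/-- `K(w, u, a, x) = dF(w, u | a, x) / (dF(w | a, x) dF(u | a, x))`. -/
def densityRatio (Q : Measure (ℝ × 𝒲 × 𝒰)) : 𝒲 × 𝒰 → ℝ :=
  fun z => ((lawWU Q).rnDeriv ((lawW Q).prod (lawU Q)) z).toReal

/-- Completeness of `W` for `U` given `A = a, X = x`: a square integrable `f` with
`E{f(U) | W = w, a, x} = 0` for almost all `w` vanishes almost surely. -/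
def Complete [StandardBorelSpace 𝒰] [Nonempty 𝒰] (Q : Measure (ℝ × 𝒲 × 𝒰))
    [IsFiniteMeasure Q] : Prop :=
  ∀ f : 𝒰 → ℝ, MemLp f 2 (lawU Q) →
    (∀ᵐ w ∂(lawW Q), ∫ u, f u ∂(lawUGivenW Q w) = 0) → f =ᵐ[lawU Q] 0

/-- The regularity conditions at `(a, x)`. -/
structure Regular (Q : Measure (ℝ × 𝒲 × 𝒰)) [IsFiniteMeasure Q] : Prop where
  /-- the density ratio exists -/
  abs_cont : lawWU Q ≪ (lawW Q).prod (lawU Q)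
  /-- and is square integrable, `∬ K(w, u, a, x)² dF(w | a, x) dF(u | a, x) < ∞` -/
  ratio_memLp : MemLp (densityRatio Q) 2 ((lawW Q).prod (lawU Q))
  /-- `E(Y | a, u, x)` exists -/
  outcome_integrable : ∀ᵐ u ∂(lawU Q), Integrable (fun y : ℝ => y) (lawYGivenU Q u)
  /-- and is square integrable -/
  outcome_memLp : MemLp (outcomeMean Q) 2 (lawU Q)
  /-- Picard's condition for the operator `K_{a,x}` with kernel `K(w, u, a, x)`. The value of the
  sum is the same for all singular systems of an operator. -/
  picard : ∀ (ι : Type) [Countable ι] (ν : ι → ℝ) (υ : ι → Lp ℝ 2 (lawW Q))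
    (κ : ι → Lp ℝ 2 (lawU Q)),
    IsSingularSystem (integralOperator (densityRatio Q) ratio_memLp) ν υ κ →
      Summable fun i => 1 / ν i ^ 2 * |inner ℝ (outcome_memLp.toLp (outcomeMean Q)) (κ i)| ^ 2

/-- `g = h(·, a, x)` is a square integrable solution of
`E(Y | A = a, U = u, X = x) = E{g(W) | A = a, U = u, X = x}` for almost all `u`. -/
structure SolvesBridgeEquation [StandardBorelSpace 𝒲] [Nonempty 𝒲]
    (Q : Measure (ℝ × 𝒲 × 𝒰)) [IsFiniteMeasure Q] (g : 𝒲 → ℝ) : Prop where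
  memLp : MemLp g 2 (lawW Q)
  integrable : ∀ᵐ u ∂(lawU Q), Integrable g (lawWGivenU Q u)
  equation : ∀ᵐ u ∂(lawU Q), outcomeMean Q u = ∫ w, g w ∂(lawWGivenU Q u)

end Fibre

end ConfoundingBridge

end

open Filter Topology

universe v

namespace ConfoundingBridge


/-! ### Hilbert space tools: singular systems, Picard's criterion, Landweber averages. -/

section Hilbert

/-! Fix `t = (a, x)`. The bridge equation reads `K g = m` with `K g = E{g(W) | U}`, `m = E(Y | a, ·,
x)` and `K* f = E{f(U) | W}`. The square integrable density makes `K` compact, so it has a singular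
system; completeness says that `K*` is injective, so the vectors `κ i` are total, and Picard's
condition then yields a solution (`IsSingularSystem.mem_range`).

Separate choices for each `t` need not be measurable in `t`. Hence a solution is approximated by the
Landweber iteration `g ↦ g + K*(m - K g)` started at `0`, written with conditional kernels that are
jointly measurable in `t`. As `K` is a contraction, so is `1 - K*K`, and the mean ergodic theorem
makes the averages of the iterates converge in `L²` to a solution on each good fibre. A subsequence
depending measurably on `t` converges almost everywhere, and its limsup is the measurable `h`. The
approximants are defined for every `t`, so `T` may be an arbitrary set. -/

lemma _root_.Orthonormal.countable {E : Type*} [NormedAddCommGroup E] [InnerProductSpace ℝ E]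
    [SecondCountableTopology E] {ι : Type*} {v : ι → E}
    (hv : Orthonormal ℝ v) : Countable ι := by
  -- Orthonormal vectors are `√2 > 1` apart, and a separable space has only countably many disjoint
  -- nonempty open sets.
  have hdisj : (Set.univ : Set ι).PairwiseDisjoint fun i => Metric.ball (v i) (1 / 2) := by
    intro i _ j _ hij
    refine Metric.ball_disjoint_ball ?_
    have h : ‖v i - v j‖ ^ 2 = 2 := by
      rw [norm_sub_sq_real, hv.1 i, hv.1 j, hv.2 hij]; norm_num
    rw [dist_eq_norm]
    nlinarith [norm_nonneg (v i - v j)]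
  have := hdisj.countable_of_isOpen (fun _ _ => Metric.isOpen_ball)
    (fun i _ => ⟨v i, Metric.mem_ball_self (by norm_num)⟩)
  exact Set.countable_univ_iff.mp this

variable {E F : Type*} [NormedAddCommGroup E] [InnerProductSpace ℝ E] [CompleteSpace E]
  [NormedAddCommGroup F] [InnerProductSpace ℝ F] [CompleteSpace F]

/-- A compact self-adjoint operator has a Hilbert basis of eigenvectors. -/
lemma exists_hilbertBasis_eigenvectors {E : Type v} [NormedAddCommGroup E]
    [InnerProductSpace ℝ E] [CompleteSpace E] {T : E →L[ℝ] E} (hT : IsCompactOperator T)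
    (hT' : (T : E →ₗ[ℝ] E).IsSymmetric) :
    ∃ (ι : Type v) (b : HilbertBasis ι ℝ E) (μ : ι → ℝ), ∀ i, T (b i) = μ i • b i := by
  have hcl : ∀ μ : ℝ, IsClosed (Module.End.eigenspace (T : Module.End ℝ E) μ : Set E) := by
    intro μ
    have : (Module.End.eigenspace (T : Module.End ℝ E) μ : Set E) = {x | T x = μ • x} := by
      ext x; simp
    rw [this]
    exact isClosed_eq T.continuous (continuous_const_smul μ)
  have : ∀ μ : ℝ, CompleteSpace (Module.End.eigenspace (T : Module.End ℝ E) μ) :=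
    fun μ => (hcl μ).completeSpace_coe
  choose w b hb using fun μ : ℝ =>
    exists_hilbertBasis ℝ (Module.End.eigenspace (T : Module.End ℝ E) μ)
  have hon := hT'.orthogonalFamily_eigenspaces.orthonormal_sigma_orthonormal
    (v_family := fun μ => b μ) (fun μ => (b μ).orthonormal)
  have hbot := ContinuousLinearMap.orthogonalComplement_iSup_eigenspaces_eq_bot hT hT'
  refine ⟨Σ μ : ℝ, w μ, HilbertBasis.mkOfOrthogonalEqBot hon ?_, fun i => i.1, ?_⟩
  -- The closed span of the chosen vectors contains every eigenspace, by expansion in that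
  -- eigenspace's own basis.
  · rw [eq_bot_iff, ← hbot]
    rw [← Submodule.orthogonal_closure (Submodule.span ℝ _)]
    refine Submodule.orthogonal_le (iSup_le fun μ x hx => ?_)
    have h1 := ((b μ).hasSum_repr ⟨x, hx⟩).mapL (Submodule.subtypeL _)
    refine (Submodule.isClosed_topologicalClosure _).mem_of_tendsto h1
      (Eventually.of_forall fun s => ?_)
    refine Submodule.sum_mem _ fun i _ => ?_
    rw [map_smul]
    refine Submodule.smul_mem _ _ (Submodule.le_topologicalClosure _ (Submodule.subset_span ?_))
    exact ⟨⟨μ, i⟩, rfl⟩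
  · intro i
    rw [HilbertBasis.coe_mkOfOrthogonalEqBot]
    exact Module.End.mem_eigenspace_iff.mp (b i.1 i.2).2

/-- A compact operator on a separable Hilbert space has a singular system. -/
theorem exists_isSingularSystem [SecondCountableTopology E] {K : E →L[ℝ] F}
    (hK : IsCompactOperator K) :
    ∃ (ι : Type) (_ : Countable ι) (ν : ι → ℝ) (υ : ι → E) (κ : ι → F),
      IsSingularSystem K ν υ κ := by
  have hsymm : ((K.adjoint ∘L K : E →L[ℝ] E) : E →ₗ[ℝ] E).IsSymmetric := by
    intro x y
    simp [ContinuousLinearMap.adjoint_inner_left, ContinuousLinearMap.adjoint_inner_right]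
  obtain ⟨ι, b, μ, hb⟩ := exists_hilbertBasis_eigenvectors
    (T := K.adjoint ∘L K) (hK.clm_comp K.adjoint) hsymm
  have hin : ∀ i j, inner ℝ (K (b i)) (K (b j)) = μ j * inner ℝ (b i) (b j) := by
    intro i j
    rw [← ContinuousLinearMap.adjoint_inner_right, ← inner_smul_right]
    congr 1
    exact hb j
  have hnorm : ∀ i, ‖K (b i)‖ ^ 2 = μ i := by
    intro i
    rw [← real_inner_self_eq_norm_sq, hin, real_inner_self_eq_norm_sq, b.orthonormal.1]; simp
  have : Countable ι := b.orthonormal.countable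
  -- `ι` lives in the universe of `E`, while a singular system is indexed in `Type`; a copy inside
  -- `ℕ` is used instead. Only the indices with positive eigenvalue `μ i = ‖K (b i)‖ ^ 2` are kept.
  obtain ⟨f, hf⟩ := exists_injective_nat ι
  let e : Set.range f ≃ ι := (Equiv.ofInjective f hf).symm
  let g : {j : Set.range f // 0 < μ (e j)} → ι := fun j => e j.1
  have hg : Function.Injective g := fun i j h => Subtype.ext (e.injective h)
  have hpos : ∀ j, 0 < ‖K (b (g j))‖ := fun j =>
    (sq_pos_iff.mp ((hnorm (g j)).symm ▸ j.2)).lt_of_le' (norm_nonneg _)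
  refine ⟨{j : Set.range f // 0 < μ (e j)}, inferInstance, fun j => ‖K (b (g j))‖,
    fun j => b (g j), fun j => ‖K (b (g j))‖⁻¹ • K (b (g j)), hpos, ?_, ⟨?_, ?_⟩, ?_, ?_, ?_⟩
  · exact b.orthonormal.comp g hg
  · intro j
    rw [norm_smul, norm_inv, norm_norm, inv_mul_cancel₀ (hpos j).ne']
  · intro i j hij
    dsimp only
    rw [inner_smul_left, inner_smul_right, hin, b.orthonormal.2 (hg.ne hij)]
    simp
  · intro j
    rw [smul_smul, mul_inv_cancel₀ (hpos j).ne', one_smul]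
  · intro j
    have h1 : K.adjoint (K (b (g j))) = μ (g j) • b (g j) := hb (g j)
    rw [map_smul, h1, smul_smul, ← hnorm]
    congr 1
    field_simp [(hpos j).ne']
  · intro h
    have h1 := (b.hasSum_repr h).mapL K
    rw [← hg.hasSum_iff] at h1
    · convert h1 using 2 with j
      simp only [Function.comp_apply, map_smul, b.repr_apply_apply, smul_smul]
      congr 1
      field_simp [(hpos j).ne']
    -- A discarded basis vector is killed by `K`, so it adds nothing to the expansion.
    · intro i hi
      have : ¬ 0 < μ i := fun h => hi ⟨⟨e.symm i, by simpa using h⟩, by simp [g]⟩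
      have h0 : ‖K (b i)‖ ^ 2 ≤ 0 := by rw [hnorm]; exact not_lt.mp this
      have : K (b i) = 0 := by
        rw [← norm_eq_zero]; exact pow_eq_zero_iff two_ne_zero |>.mp (le_antisymm h0 (sq_nonneg _))
      rw [map_smul, this, smul_zero]

/-- An operator with square summable images of a Hilbert basis under the adjoint is compact. -/
lemma isCompactOperator_of_summable_adjoint {ι : Type*} (b : HilbertBasis ι ℝ F) (K : E →L[ℝ] F)
    (hs : Summable fun i => ‖K.adjoint (b i)‖ ^ 2) : IsCompactOperator K := by
  classical
  -- The finite rank operator `R s` is `K` followed by the projection onto the span of `b i`, `i ∈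
  -- s`.
  let R : Finset ι → E →L[ℝ] F := fun s =>
    ∑ i ∈ s, (innerSL ℝ (K.adjoint (b i))).smulRight (b i)
  have hR : ∀ s x, R s x = ∑ i ∈ s, inner ℝ (b i) (K x) • b i := by
    intro s x
    simp [R, ContinuousLinearMap.adjoint_inner_left]
  have hcomp : ∀ s, IsCompactOperator (R s) := by
    intro s
    refine Finset.sum_induction _ (fun T : E →L[ℝ] F => IsCompactOperator T) ?_ ?_ ?_
    · exact fun _ _ h1 h2 => h1.add h2
    · exact isCompactOperator_zero
    · intro i _
      have : IsCompactOperator (innerSL ℝ (K.adjoint (b i)) : E →L[ℝ] ℝ) :=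
        isCompactOperator_of_locallyCompactSpace_dom (innerSL ℝ (K.adjoint (b i)))
      exact this.clm_comp (ContinuousLinearMap.toSpanSingleton ℝ (b i))
  refine isCompactOperator_of_tendsto (l := atTop) (F := R) ?_ (Eventually.of_forall hcomp)
  -- Parseval gives `‖K x - R s x‖² = ∑ ⟨K* (b i), x⟩²` over `i ∉ s`; Cauchy–Schwarz bounds each
  -- term.
  have hbound : ∀ s, ‖R s - K‖ ≤ √(∑' i : {i // i ∉ s}, ‖K.adjoint (b i)‖ ^ 2) := by
    intro s
    refine ContinuousLinearMap.opNorm_le_bound _ (Real.sqrt_nonneg _) fun x => ?_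
    have h1 : HasSum (fun i : {i // i ∉ s} => inner ℝ (b i) (K x) • b i) (K x - R s x) := by
      have h2 : HasSum (fun i => inner ℝ (b i) (K x) • b i) (K x) := by
        simpa [b.repr_apply_apply] using b.hasSum_repr (K x)
      rw [hR]
      exact (Finset.hasSum_iff_compl s).1 h2
    have h3 : HasSum (fun i : {i // i ∉ s} => inner ℝ (b i) (K x) ^ 2) (‖K x - R s x‖ ^ 2) := by
      have h4 := h1.mapL (innerSL ℝ (K x - R s x))
      simp only [innerSL_apply_apply, real_inner_self_eq_norm_sq] at h4
      refine Eq.subst (motive := fun f => HasSum f (‖K x - R s x‖ ^ 2))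
        (funext fun i => ?_) h4
      have h5 : inner ℝ (b i) (K x - R s x) = inner ℝ (b i) (K x) := by
        rw [inner_sub_right, hR, inner_sum]
        rw [Finset.sum_eq_zero, sub_zero]
        intro j hj
        rw [inner_smul_right, b.orthonormal.2 (i := i.1) (j := j) (fun h => i.2 (h ▸ hj)),
          mul_zero]
      rw [inner_smul_right, real_inner_comm (b i), h5, sq]
    have h6 : ‖K x - R s x‖ ^ 2 ≤ (∑' i : {i // i ∉ s}, ‖K.adjoint (b i)‖ ^ 2) * ‖x‖ ^ 2 := by
      rw [← tsum_mul_right]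
      refine hasSum_le (fun i => ?_) h3 ((hs.subtype _).mul_right _).hasSum
      rw [Function.comp_apply, ← mul_pow, ← ContinuousLinearMap.adjoint_inner_left]
      exact sq_le_sq.mpr (by simpa using abs_real_inner_le_norm (K.adjoint (b i)) x)
    rw [sub_apply, norm_sub_rev]
    refine abs_le_of_sq_le_sq' ?_ (by positivity) |>.2
    rw [mul_pow, Real.sq_sqrt (tsum_nonneg fun _ => sq_nonneg _)]
    exact h6
  rw [tendsto_iff_norm_sub_tendsto_zero]
  refine squeeze_zero (fun _ => norm_nonneg _) hbound ?_
  have := (tendsto_tsum_compl_atTop_zero fun i => ‖K.adjoint (b i)‖ ^ 2).sqrt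
  simpa using this

/-- Picard's criterion: if `K*` is injective, a point whose coefficients along a singular system are
square summable after division by the singular values is in the range of `K`. -/
theorem IsSingularSystem.mem_range {K : E →L[ℝ] F} {ι : Type} {ν : ι → ℝ} {υ : ι → E} {κ : ι → F}
    (h : IsSingularSystem K ν υ κ) (hinj : ∀ y, K.adjoint y = 0 → y = 0) {y : F}
    (hy : Summable fun i => 1 / ν i ^ 2 * |inner ℝ y (κ i)| ^ 2) : ∃ x, K x = y := by
  -- A vector orthogonal to all `κ i` is orthogonal to the range of `K` by the expansion, so it lies
  -- in `ker K* = 0`.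
  have hker : ∀ z : F, (∀ i, inner ℝ (κ i) z = 0) → z = 0 := by
    intro z hz
    refine hinj z (ext_inner_right ℝ fun x => ?_)
    rw [ContinuousLinearMap.adjoint_inner_left, inner_zero_left]
    have := (h.expansion x).mapL (innerSL ℝ z)
    have h0 : ∀ i, innerSL ℝ z ((ν i * inner ℝ (υ i) x) • κ i) = 0 := fun i => by
      rw [innerSL_apply_apply, inner_smul_right, real_inner_comm (κ i), hz, mul_zero]
    simp only [h0] at this
    exact this.unique hasSum_zero
  have hsum : Summable fun i => ((ν i)⁻¹ * inner ℝ (κ i) y) • υ i := by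
    have := (h.orthonormal_left.orthogonalFamily).summable_iff_norm_sq_summable
      (fun i => (ν i)⁻¹ * inner ℝ (κ i) y)
    simp only [LinearIsometry.toSpanSingleton_apply] at this
    rw [this]
    convert hy using 2 with i
    rw [norm_mul, mul_pow, norm_inv, inv_pow, Real.norm_eq_abs, Real.norm_eq_abs, sq_abs (ν i),
      one_div, real_inner_comm]
  -- The formal inverse of the expansion; `K x - y` is orthogonal to every `κ i`.
  refine ⟨∑' i, ((ν i)⁻¹ * inner ℝ (κ i) y) • υ i, sub_eq_zero.mp (hker _ fun i => ?_)⟩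
  rw [inner_sub_right, sub_eq_zero, ← ContinuousLinearMap.adjoint_inner_left, h.map_right,
    inner_smul_left]
  have h1 := hsum.hasSum.mapL (innerSL ℝ (υ i))
  have h2 : HasSum (fun j => innerSL ℝ (υ i) (((ν j)⁻¹ * inner ℝ (κ j) y) • υ j))
      ((ν i)⁻¹ * inner ℝ (κ i) y) := by
    convert hasSum_single i fun j hj => ?_ using 1
    · simp [h.orthonormal_left.1]
    · simp [h.orthonormal_left.2 hj.symm]
  have h3 := h1.unique h2
  rw [innerSL_apply_apply] at h3
  rw [h3]
  have := (h.pos i).ne'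
  simp only [conj_trivial]
  field_simp

/-- For a contraction `K`, the averages of the Landweber iterates of a solvable equation `K x = y`
converge to a solution. -/
theorem exists_tendsto_landweber_average {K : E →L[ℝ] F} (hK : ‖K‖ ≤ 1) {y : F}
    (hy : ∃ x, K x = y) {x : ℕ → E} (hx : ∀ n, x (n + 1) = x n + K.adjoint (y - K (x n))) :
    ∃ z, K z = y ∧ Tendsto (fun N : ℕ => (N : ℝ)⁻¹ • ∑ n ∈ Finset.range N, x n) atTop (𝓝 z) := by
  obtain ⟨x', rfl⟩ := hy
  -- The error evolves linearly: `x n - x' = R^n (x 0 - x')`. Moreover `‖R v‖² = ‖v‖² - 2‖K v‖² +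
  -- ‖K* K v‖² ≤ ‖v‖²`.
  let R : E →L[ℝ] E := 1 - K.adjoint ∘L K
  have hR : ‖R‖ ≤ 1 := by
    refine ContinuousLinearMap.opNorm_le_bound _ zero_le_one fun v => ?_
    rw [one_mul]
    have h1 : ‖K.adjoint (K v)‖ ≤ ‖K v‖ := by
      have := K.adjoint.le_of_opNorm_le ((LinearIsometryEquiv.norm_map _ K).le.trans hK) (K v)
      simpa using this
    have h2 : ‖R v‖ ^ 2 ≤ ‖v‖ ^ 2 := by
      change ‖v - K.adjoint (K v)‖ ^ 2 ≤ _
      rw [norm_sub_sq_real, ContinuousLinearMap.adjoint_inner_right, real_inner_self_eq_norm_sq]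
      nlinarith [norm_nonneg (K.adjoint (K v)), norm_nonneg (K v)]
    exact abs_le_of_sq_le_sq' h2 (norm_nonneg _) |>.2
  have hit : ∀ n, x n = x' + R^[n] (x 0 - x') := by
    intro n
    induction n with
    | zero => simp
    | succ n ih =>
      have : R^[n] (x 0 - x') = x n - x' := by rw [ih]; abel
      rw [Function.iterate_succ_apply', this, hx]
      change _ = x' + ((x n - x') - K.adjoint (K (x n - x')))
      simp only [map_sub]
      abel
  -- Mean ergodic theorem: the averaged errors tend to their projection on the fixed space of `R`,
  -- which is `ker K*K = ker K`; the limit is therefore still a solution.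
  have hlim := R.tendsto_birkhoffAverage_orthogonalProjection hR (x 0 - x')
  set z := (R.eqLocus (1 : E →L[ℝ] E)).orthogonalProjectionOnto (x 0 - x') with hz
  have hz0 : K z = 0 := by
    have h1 : R z = z := z.2
    have h2 : (z : E) - K.adjoint (K z) = z := h1
    have h3 : K.adjoint (K z) = 0 := by simpa using h2
    have h4 : ‖K z‖ ^ 2 = 0 := by
      rw [← real_inner_self_eq_norm_sq, ← ContinuousLinearMap.adjoint_inner_right, h3,
        inner_zero_right]
    simpa using h4
  refine ⟨x' + z, by rw [map_add, hz0, add_zero], ?_⟩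
  refine (tendsto_const_nhds.add hlim).congr' ?_
  filter_upwards [eventually_ne_atTop 0] with N hN
  simp only [birkhoffAverage, birkhoffSum, id]
  rw [Finset.sum_congr rfl fun n _ => hit n, Finset.sum_add_distrib, smul_add, Finset.sum_const, Finset.card_range, ← Nat.cast_smul_eq_nsmul ℝ,
    smul_smul, inv_mul_cancel₀ (by exact_mod_cast hN), one_smul]

end Hilbert


/-! ### Integral operators with square integrable kernel: adjoint and compactness. -/

lemma real_inner_eq_mul (a b : ℝ) : inner ℝ a b = a * b := by
  simp [mul_comm]

lemma kernelIntegral_congr {𝒲 𝒰 : Type*} [MeasurableSpace 𝒲] {p : Measure 𝒲} {k : 𝒲 × 𝒰 → ℝ}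
    {g g' : 𝒲 → ℝ} (h : g =ᵐ[p] g') : kernelIntegral p k g = kernelIntegral p k g' := by
  funext u
  refine integral_congr_ae ?_
  filter_upwards [h] with w hw
  rw [hw]

lemma memLp_two_mul_prod {𝒲 𝒰 : Type*} [MeasurableSpace 𝒲] [MeasurableSpace 𝒰] {p : Measure 𝒲}
    {q : Measure 𝒰} [SFinite p] [SFinite q] {g : 𝒲 → ℝ} {f : 𝒰 → ℝ} (hg : MemLp g 2 p)
    (hf : MemLp f 2 q) :
    MemLp (fun z : 𝒲 × 𝒰 => g z.1 * f z.2) 2 (p.prod q) := by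
  refine (memLp_two_iff_integrable_sq (hg.1.comp_fst.mul hf.1.comp_snd)).2 ?_
  simp only [Pi.mul_apply, mul_pow]
  exact hg.integrable_sq.mul_prod hf.integrable_sq

section IntegralOperator

variable {𝒲 𝒰 : Type*} [MeasurableSpace 𝒲] [MeasurableSpace 𝒰]
  {p : Measure 𝒲} {q : Measure 𝒰} [IsFiniteMeasure p] [IsFiniteMeasure q]

lemma memLp_comp_swap {k : 𝒲 × 𝒰 → ℝ} (hk : MemLp k 2 (p.prod q)) :
    MemLp (k ∘ Prod.swap) 2 (q.prod p) :=
  hk.comp_measurePreserving Measure.measurePreserving_swap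

lemma coeFn_integralOperator {k : 𝒲 × 𝒰 → ℝ} (hk : MemLp k 2 (p.prod q)) (g : Lp ℝ 2 p) :
    integralOperator k hk g =ᵐ[q] kernelIntegral p k g :=
  (memLp_kernelIntegral hk (Lp.memLp g)).coeFn_toLp

lemma integralOperator_toLp {k : 𝒲 × 𝒰 → ℝ} (hk : MemLp k 2 (p.prod q)) {g : 𝒲 → ℝ}
    (hg : MemLp g 2 p) :
    integralOperator k hk (hg.toLp g) =
      (memLp_kernelIntegral hk hg).toLp (kernelIntegral p k g) :=
  MemLp.toLp_congr (memLp_kernelIntegral hk (Lp.memLp _)) _ (by rw [kernelIntegral_congr hg.coeFn_toLp])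

/-- Fubini puts the bilinear form in a shape symmetric in the two variables; both the adjoint and
the contraction bound are read off from it. -/
lemma inner_integralOperator {k : 𝒲 × 𝒰 → ℝ} (hk : MemLp k 2 (p.prod q)) (g : Lp ℝ 2 p)
    (f : Lp ℝ 2 q) :
    inner ℝ f (integralOperator k hk g) = ∫ z, k z * (g z.1 * f z.2) ∂(p.prod q) := by
  have hint : Integrable (fun z : 𝒲 × 𝒰 => k z * (g z.1 * f z.2)) (p.prod q) :=
    hk.integrable_mul (memLp_two_mul_prod (Lp.memLp g) (Lp.memLp f))
  rw [integral_prod_symm _ hint, L2.inner_def]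
  refine integral_congr_ae ?_
  filter_upwards [coeFn_integralOperator hk g] with u hu
  rw [hu, kernelIntegral, real_inner_eq_mul, ← integral_const_mul]
  refine integral_congr_ae (Eventually.of_forall fun w => ?_)
  dsimp only
  ring

lemma adjoint_integralOperator {k : 𝒲 × 𝒰 → ℝ} (hk : MemLp k 2 (p.prod q)) :
    (integralOperator k hk).adjoint = integralOperator (k ∘ Prod.swap) (memLp_comp_swap hk) := by
  refine ContinuousLinearMap.ext fun f => ext_inner_left ℝ fun g => ?_
  rw [ContinuousLinearMap.adjoint_inner_right, real_inner_comm, inner_integralOperator,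
    inner_integralOperator, ← integral_prod_swap]
  refine integral_congr_ae (Eventually.of_forall fun z => ?_)
  simp only [Function.comp_apply, Prod.fst_swap, Prod.snd_swap]
  ring

/-- An integral operator with square integrable kernel is compact. -/
theorem isCompactOperator_integralOperator {k : 𝒲 × 𝒰 → ℝ} (hk : MemLp k 2 (p.prod q)) :
    IsCompactOperator (integralOperator k hk) := by
  obtain ⟨ι, b, -⟩ := exists_hilbertBasis ℝ (Lp ℝ 2 q)
  refine isCompactOperator_of_summable_adjoint b _ ?_
  have hsq : Integrable (fun w => ∫ u, k (w, u) ^ 2 ∂q) p := hk.integrable_sq.integral_prod_left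
  have hint : ∀ i, MemLp (kernelIntegral q (k ∘ Prod.swap) (b i)) 2 p := fun i =>
    memLp_kernelIntegral (memLp_comp_swap hk) (Lp.memLp _)
  have hnorm : ∀ i, ‖(integralOperator k hk).adjoint (b i)‖ ^ 2 =
      ∫ w, kernelIntegral q (k ∘ Prod.swap) (b i) w ^ 2 ∂p := by
    intro i
    rw [adjoint_integralOperator, ← real_inner_self_eq_norm_sq, L2.inner_def]
    refine integral_congr_ae ?_
    filter_upwards [coeFn_integralOperator (memLp_comp_swap hk) (b i)] with w hw
    rw [hw, real_inner_eq_mul, sq]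
  -- `(K* (b i))(w)` is the coefficient of the slice `k (w, ·)` along `b i`, so Bessel's inequality
  -- for almost every `w`, integrated, bounds the sum by `∬ k²`.
  refine summable_of_sum_le (c := ∫ w, ∫ u, k (w, u) ^ 2 ∂q ∂p) (fun _ => sq_nonneg _) fun s => ?_
  simp_rw [hnorm]
  rw [← integral_finsetSum _ fun i _ => (hint i).integrable_sq]
  refine integral_mono_ae (integrable_finsetSum _ fun i _ => (hint i).integrable_sq) hsq ?_
  filter_upwards [hk.integrable_sq.prod_right_ae, hk.1.prodMk_left] with w hw hw'
  have hmem : MemLp (fun u => k (w, u)) 2 q := (memLp_two_iff_integrable_sq hw').2 hw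
  have hbessel := b.orthonormal.sum_inner_products_le (s := s) (hmem.toLp _)
  have h1 : ∀ i, inner ℝ (b i) (hmem.toLp _) = kernelIntegral q (k ∘ Prod.swap) (b i) w := by
    intro i
    rw [L2.inner_def]
    refine integral_congr_ae ?_
    filter_upwards [hmem.coeFn_toLp] with u hu
    rw [hu, real_inner_eq_mul, mul_comm]
    rfl
  have h2 : ‖hmem.toLp _‖ ^ 2 = ∫ u, k (w, u) ^ 2 ∂q := by
    rw [← real_inner_self_eq_norm_sq, L2.inner_def]
    refine integral_congr_ae ?_
    filter_upwards [hmem.coeFn_toLp] with u hu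
    rw [hu, real_inner_eq_mul, sq]
  simpa only [h1, h2, Real.norm_eq_abs, sq_abs] using hbessel

end IntegralOperator

/-! ### Conditional expectations on one fibre as integral operators. -/

/-- If the joint law of `(V, Z)` has density `k` with respect to the product of its marginals, then
`E{g(Z) | V = v} = ∫ k(v, z) g(z) dF(z)`. -/
lemma integral_condDistrib_ae_eq {Ω α β : Type*} [MeasurableSpace Ω] [MeasurableSpace α]
    [MeasurableSpace β] [StandardBorelSpace β] [Nonempty β] {Q : Measure Ω} [IsFiniteMeasure Q]
    {V : Ω → α} {Z : Ω → β} (hV : Measurable V) (hZ : Measurable Z) {k : α × β → ℝ}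
    (hk : MemLp k 2 ((Q.map V).prod (Q.map Z)))
    (hd : ∀ φ : α × β → ℝ, ∫ z, φ z ∂(Q.map fun ω => (V ω, Z ω)) =
      ∫ z, k z * φ z ∂((Q.map V).prod (Q.map Z)))
    {g : β → ℝ} (hg : MemLp g 2 (Q.map Z)) :
    (fun v => ∫ z, g z ∂(condDistrib Z V Q v)) =ᵐ[Q.map V]
      fun v => ∫ z, k (v, z) * g z ∂(Q.map Z) := by
  have hJ : Integrable (fun x : α × β => g x.2) (Q.map fun ω => (V ω, Z ω)) := by
    have h1 : Integrable g ((Q.map fun ω => (V ω, Z ω)).map Prod.snd) := by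
      rw [Measure.map_map measurable_snd (hV.prodMk hZ)]
      exact hg.integrable (by norm_num)
    exact h1.comp_measurable measurable_snd
  have hP : Integrable (fun z : α × β => k z * g z.2) ((Q.map V).prod (Q.map Z)) :=
    hk.integrable_mul (hg.comp_snd _)
  -- Over each measurable `s` both sides integrate to the integral over `s ×ˢ univ`, under the joint
  -- law and under the product law with density `k`; `hd` identifies the two.
  refine Integrable.ae_eq_of_forall_setIntegral_eq _ _
    (hJ.integral_condDistrib_map hZ.aemeasurable) hP.integral_prod_left fun s hs _ => ?_
  have e1 : ∫ v in s, ∫ z, g z ∂(condDistrib Z V Q v) ∂(Q.map V) =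
      ∫ x in s ×ˢ Set.univ, g x.2 ∂(Q.map fun ω => (V ω, Z ω)) := by
    rw [← compProd_map_condDistrib hZ.aemeasurable] at hJ ⊢
    rw [Measure.setIntegral_compProd hs MeasurableSet.univ hJ.integrableOn]
    simp
  have e2 : ∫ v in s, ∫ z, k (v, z) * g z ∂(Q.map Z) ∂(Q.map V) =
      ∫ x in s ×ˢ Set.univ, k x * g x.2 ∂((Q.map V).prod (Q.map Z)) := by
    rw [setIntegral_prod _ hP.integrableOn]
    simp
  rw [e1, e2, ← integral_indicator (hs.prod MeasurableSet.univ), hd,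
    ← integral_indicator (hs.prod MeasurableSet.univ)]
  refine integral_congr_ae (Eventually.of_forall fun z => ?_)
  by_cases hz : z ∈ s ×ˢ (Set.univ : Set β) <;> simp [hz]

section Fibre

variable {𝒲 𝒰 : Type*} [MeasurableSpace 𝒲] [MeasurableSpace 𝒰]
  {Q : Measure (ℝ × 𝒲 × 𝒰)} [IsFiniteMeasure Q]

lemma integral_lawWU (hac : lawWU Q ≪ (lawW Q).prod (lawU Q)) (φ : 𝒲 × 𝒰 → ℝ) :
    ∫ z, φ z ∂(lawWU Q) = ∫ z, densityRatio Q z * φ z ∂((lawW Q).prod (lawU Q)) :=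
  (integral_rnDeriv_smul hac).symm

/-- `(K g)(u) = E{g(W) | U = u}`. -/
lemma integral_lawWGivenU_ae_eq [StandardBorelSpace 𝒲] [Nonempty 𝒲]
    (hac : lawWU Q ≪ (lawW Q).prod (lawU Q))
    (hk : MemLp (densityRatio Q) 2 ((lawW Q).prod (lawU Q))) {g : 𝒲 → ℝ}
    (hg : MemLp g 2 (lawW Q)) :
    (fun u => ∫ w, g w ∂(lawWGivenU Q u)) =ᵐ[lawU Q]
      kernelIntegral (lawW Q) (densityRatio Q) g := by
  refine integral_condDistrib_ae_eq (k := densityRatio Q ∘ Prod.swap)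
    (by fun_prop : Measurable fun z : ℝ × 𝒲 × 𝒰 => z.2.2) (by fun_prop) (memLp_comp_swap hk)
    (fun φ => ?_) hg
  have h1 : Q.map (fun z : ℝ × 𝒲 × 𝒰 => (z.2.2, z.2.1)) = (lawWU Q).map Prod.swap := by
    rw [lawWU, Measure.map_map measurable_swap measurable_snd]; rfl
  rw [h1]
  have h2 : ∫ z, φ z ∂((lawWU Q).map Prod.swap) = ∫ z, φ z.swap ∂(lawWU Q) :=
    MeasurableEquiv.prodComm.measurableEmbedding.integral_map φ
  rw [h2, integral_lawWU hac]
  exact (integral_prod_swap (μ := lawW Q) (ν := lawU Q)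
    (fun z => densityRatio Q z * φ z.swap)).symm

/-- `(K* f)(w) = E{f(U) | W = w}`. -/
lemma integral_lawUGivenW_ae_eq [StandardBorelSpace 𝒰] [Nonempty 𝒰]
    (hac : lawWU Q ≪ (lawW Q).prod (lawU Q))
    (hk : MemLp (densityRatio Q) 2 ((lawW Q).prod (lawU Q))) {f : 𝒰 → ℝ}
    (hf : MemLp f 2 (lawU Q)) :
    (fun w => ∫ u, f u ∂(lawUGivenW Q w)) =ᵐ[lawW Q]
      kernelIntegral (lawU Q) (densityRatio Q ∘ Prod.swap) f :=
  integral_condDistrib_ae_eq (k := densityRatio Q)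
    (by fun_prop : Measurable fun z : ℝ × 𝒲 × 𝒰 => z.2.1) (by fun_prop) hk
    (integral_lawWU hac) hf

/-- The operator `K` is a contraction. -/
lemma norm_integralOperator_densityRatio_le (hac : lawWU Q ≪ (lawW Q).prod (lawU Q))
    (hk : MemLp (densityRatio Q) 2 ((lawW Q).prod (lawU Q))) :
    ‖integralOperator (densityRatio Q) hk‖ ≤ 1 := by
  have hfst : MeasurePreserving Prod.fst (lawWU Q) (lawW Q) :=
    ⟨measurable_fst, by rw [lawWU, Measure.map_map measurable_fst measurable_snd]; rfl⟩
  have hsnd : MeasurePreserving Prod.snd (lawWU Q) (lawU Q) :=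
    ⟨measurable_snd, by rw [lawWU, Measure.map_map measurable_snd measurable_snd]; rfl⟩
  -- `⟨f, K g⟩ = E{f(U) g(W)}`: Cauchy–Schwarz applies in `L²` of the joint law, whose marginals
  -- give back the norms of `f` and `g`. The bound on `K` follows with `f = K g`.
  have hinner : ∀ (g : Lp ℝ 2 (lawW Q)) (f : Lp ℝ 2 (lawU Q)),
      inner ℝ f (integralOperator (densityRatio Q) hk g) ≤ ‖f‖ * ‖g‖ := by
    intro g f
    rw [inner_integralOperator, ← integral_lawWU hac, ← Lp.norm_compMeasurePreserving g hfst,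
      ← Lp.norm_compMeasurePreserving f hsnd]
    refine le_trans (le_of_eq ?_) (real_inner_le_norm _ _)
    rw [L2.inner_def]
    refine integral_congr_ae ?_
    filter_upwards [Lp.coeFn_compMeasurePreserving g hfst,
      Lp.coeFn_compMeasurePreserving f hsnd] with z h1 h2
    rw [h1, h2, real_inner_eq_mul, mul_comm]
    rfl
  refine ContinuousLinearMap.opNorm_le_bound _ zero_le_one fun g => ?_
  have h := hinner g (integralOperator (densityRatio Q) hk g)
  rw [real_inner_self_eq_norm_sq, sq] at h
  rw [one_mul]
  by_contra hlt
  push Not at hlt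
  exact absurd h (not_le.mpr (mul_lt_mul_of_pos_left hlt ((norm_nonneg g).trans_lt hlt)))

/-- Under completeness and the regularity conditions the equation `K x = E(Y | a, ·, x)` has a
solution. -/
lemma exists_integralOperator_eq [StandardBorelSpace 𝒲]
    [StandardBorelSpace 𝒰] [Nonempty 𝒰] (hc : Complete Q) (hr : Regular Q) :
    ∃ x, integralOperator (densityRatio Q) hr.ratio_memLp x =
      hr.outcome_memLp.toLp (outcomeMean Q) := by
  have : Fact ((2 : ℝ≥0∞) ≠ ∞) := ⟨ENNReal.ofNat_ne_top⟩
  obtain ⟨ι, _, ν, υ, κ, h⟩ :=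
    exists_isSingularSystem (isCompactOperator_integralOperator hr.ratio_memLp)
  -- Since `K* f = E{f(U) | W = ·}`, completeness is injectivity of `K*`.
  refine h.mem_range (fun f hf => ?_) (hr.picard ι ν υ κ h)
  refine Lp.eq_zero_iff_ae_eq_zero.mpr (hc f (Lp.memLp f) ?_)
  have h1 := coeFn_integralOperator (memLp_comp_swap hr.ratio_memLp) f
  rw [← adjoint_integralOperator hr.ratio_memLp, hf] at h1
  filter_upwards [integral_lawUGivenW_ae_eq hr.abs_cont hr.ratio_memLp (Lp.memLp f), h1,
    Lp.coeFn_zero ℝ 2 (lawW Q)] with w h2 h3 h4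
  rw [h2, ← h3, h4, Pi.zero_apply]

end Fibre


/-! ### Measurable choice of limits and of conditional laws. -/

/-- Fibrewise `L¹` limits along a kernel can be chosen jointly measurable. -/
theorem exists_measurable_fibrewise_limit {α β : Type*} [MeasurableSpace α] [MeasurableSpace β]
    (η : Kernel α β) [IsSFiniteKernel η] {g : ℕ → α × β → ℝ} (hg : ∀ n, Measurable (g n)) :
    ∃ h : α × β → ℝ, Measurable h ∧ ∀ (a : α) (z : β → ℝ), AEMeasurable z (η a) →
      Tendsto (fun n => ∫⁻ b, ‖g n (a, b) - z b‖ₑ ∂(η a)) atTop (𝓝 0) →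
        (fun b => h (a, b)) =ᵐ[η a] z := by
  classical
  -- A Cauchy criterion that does not mention the limit `z`, so that the first index satisfying it
  -- is measurable in `a`.
  let P : ℕ → α → ℕ → Prop := fun j a n =>
    ∀ m, n ≤ m → ∫⁻ b, ‖g n (a, b) - g m (a, b)‖ₑ ∂(η a) ≤ 2⁻¹ ^ j
  have hPm : ∀ j n, MeasurableSet {a | P j a n} := by
    intro j n
    have : {a | P j a n} = ⋂ m, ⋂ (_ : n ≤ m),
        {a | ∫⁻ b, ‖g n (a, b) - g m (a, b)‖ₑ ∂(η a) ≤ 2⁻¹ ^ j} := by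
      ext a; simp [P]
    rw [this]
    refine MeasurableSet.iInter fun m => MeasurableSet.iInter fun _ => ?_
    exact measurableSet_le
      (((hg n).sub (hg m)).enorm.lintegral_kernel_prod_right') measurable_const
  -- The second alternative keeps the search total: the index is `0` where no `n` works.
  have hex : ∀ j a, ∃ n, P j a n ∨ ∀ l, ¬ P j a l := by
    intro j a
    by_cases h : ∃ n, P j a n
    · exact h.imp fun n hn => Or.inl hn
    · exact ⟨0, Or.inr (not_exists.mp h)⟩
  let N : ℕ → α → ℕ := fun j a => Nat.find (hex j a)
  have hN : ∀ j, Measurable (N j) := by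
    intro j
    refine measurable_find (hex j) fun n => (hPm j n).union ?_
    have : {a | ∀ l, ¬ P j a l} = ⋂ l, {a | P j a l}ᶜ := by ext a; simp
    change MeasurableSet {a | ∀ l, ¬ P j a l}
    rw [this]
    exact MeasurableSet.iInter fun l => (hPm j l).compl
  have hgN : ∀ j, Measurable fun x : α × β => g (N j x.1) x := by
    intro j
    have h1 : Measurable fun y : ℕ × (α × β) => g y.1 y.2 :=
      measurable_from_prod_countable_right hg
    exact h1.comp (((hN j).comp measurable_fst).prodMk measurable_id)
  refine ⟨fun x => limsup (fun j => g (N j x.1) x) atTop, Measurable.limsup hgN, ?_⟩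
  intro a z hz hlim
  have hmeas : ∀ n, Measurable fun b => g n (a, b) := fun n => (hg n).comp measurable_prodMk_left
  have hmz : ∀ n, AEMeasurable (fun b => ‖g n (a, b) - z b‖ₑ) (η a) := fun n =>
    ((hmeas n).aemeasurable.sub hz).enorm
  have htri : ∀ n m, ∫⁻ b, ‖g n (a, b) - g m (a, b)‖ₑ ∂(η a) ≤
      ∫⁻ b, ‖g n (a, b) - z b‖ₑ ∂(η a) + ∫⁻ b, ‖g m (a, b) - z b‖ₑ ∂(η a) := by
    intro n m
    rw [← lintegral_add_left' (hmz n)]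
    refine lintegral_mono fun b => ?_
    have : g n (a, b) - g m (a, b) = (g n (a, b) - z b) - (g m (a, b) - z b) := by ring
    rw [this]
    exact enorm_sub_le
  have hP : ∀ j, P j a (N j a) := by
    intro j
    have h1 : ∃ n, P j a n := by
      have hpos : (0 : ℝ≥0∞) < 2⁻¹ ^ j / 2 :=
        ENNReal.half_pos (pow_ne_zero _ (ENNReal.inv_ne_zero.mpr ENNReal.ofNat_ne_top))
      obtain ⟨n, hn⟩ := eventually_atTop.mp (hlim.eventually (gt_mem_nhds hpos))
      refine ⟨n, fun m hm => (htri n m).trans ?_⟩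
      rw [← ENNReal.add_halves (2⁻¹ ^ j)]
      exact add_le_add (hn n le_rfl).le (hn m hm).le
    exact (Nat.find_spec (hex j a)).resolve_right fun h => h1.elim h
  -- Let `m → ∞` in the Cauchy bound.
  have hdist : ∀ j, ∫⁻ b, ‖g (N j a) (a, b) - z b‖ₑ ∂(η a) ≤ 2⁻¹ ^ j := by
    intro j
    have h1 : Tendsto (fun m => 2⁻¹ ^ j + ∫⁻ b, ‖g m (a, b) - z b‖ₑ ∂(η a)) atTop
        (𝓝 (2⁻¹ ^ j + 0)) := hlim.const_add _
    rw [add_zero] at h1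
    refine ge_of_tendsto h1 ?_
    filter_upwards [eventually_ge_atTop (N j a)] with m hm
    refine le_trans ?_ (add_le_add_left (hP j m hm) _)
    rw [← lintegral_add_right' _ (hmz m)]
    refine lintegral_mono fun b => ?_
    have : g (N j a) (a, b) - z b = (g (N j a) (a, b) - g m (a, b)) + (g m (a, b) - z b) := by ring
    rw [this]
    exact enorm_add_le _ _
  -- The `L¹` distances along the subsequence are summable, which forces convergence almost
  -- everywhere.
  have hsum : ∫⁻ b, ∑' j, ‖g (N j a) (a, b) - z b‖ₑ ∂(η a) ≠ ∞ := by
    rw [lintegral_tsum fun j => hmz (N j a)]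
    refine ne_top_of_le_ne_top ?_ (ENNReal.tsum_le_tsum hdist)
    rw [ENNReal.tsum_geometric]
    simp
  have hae := ae_lt_top' (AEMeasurable.tsum fun j => hmz (N j a)) hsum
  filter_upwards [hae] with b hb
  have h1 := ENNReal.tendsto_atTop_zero_of_tsum_ne_top hb.ne
  have h2 : Tendsto (fun j => g (N j a) (a, b)) atTop (𝓝 (z b)) := by
    rw [tendsto_iff_edist_tendsto_0]
    simpa only [edist_eq_enorm_sub] using h1
  exact h2.limsup_eq

/-- `condDistrib` is chosen separately for each `F a`, with no regularity in `a`; `condKernel` is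
jointly measurable. The two agree on every fibre, not merely on almost every one. -/
lemma condKernel_map_ae_eq_condDistrib {α Ω β γ : Type*} [MeasurableSpace α] [MeasurableSpace Ω]
    [MeasurableSpace β] [MeasurableSpace γ] [StandardBorelSpace γ] [Nonempty γ]
    [MeasurableSpace.CountableOrCountablyGenerated α β] (F : Kernel α Ω) [IsFiniteKernel F]
    {V : Ω → β} {Z : Ω → γ} (hV : Measurable V) (hZ : Measurable Z) (a : α) :
    ∀ᵐ v ∂((F a).map V),
      (F.map fun ω => (V ω, Z ω)).condKernel (a, v) = condDistrib Z V (F a) v := by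
  have h := Kernel.condKernel_apply_eq_condKernel (F.map fun ω => (V ω, Z ω)) a
  have hfst : (F.map fun ω => (V ω, Z ω)).fst a = (F a).map V := by
    rw [Kernel.fst_apply, Kernel.map_apply _ (hV.prodMk hZ),
      Measure.map_map measurable_fst (hV.prodMk hZ)]
    rfl
  have hcond : ((F.map fun ω => (V ω, Z ω)) a).condKernel = condDistrib Z V (F a) := by
    rw [condDistrib]
    congr 1
    exact Kernel.map_apply _ (hV.prodMk hZ) a
  rwa [hfst, hcond] at h

/-! ### Landweber iteration with jointly measurable kernels. -/

section Landweber

variable {α 𝒲 𝒰 : Type*} [MeasurableSpace α] [MeasurableSpace 𝒲] [MeasurableSpace 𝒰]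

/-- The Landweber iterates for the equation `m(t, u) = ∫ g(t, w) κ(dw | t, u)`, where `η` plays the
role of the adjoint of `κ`. -/
noncomputable def landweber (κ : Kernel (α × 𝒰) 𝒲) (η : Kernel (α × 𝒲) 𝒰) (m : α × 𝒰 → ℝ) :
    ℕ → α × 𝒲 → ℝ
  | 0 => fun _ => 0
  | n + 1 => fun z => landweber κ η m n z +
      ∫ u, (m (z.1, u) - ∫ w, landweber κ η m n (z.1, w) ∂(κ (z.1, u))) ∂(η z)

/-- Integrals along kernels preserve joint measurability without any integrability, the Bochner
integral being `0` by default; hence bad fibres do no harm. -/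
lemma stronglyMeasurable_landweber (κ : Kernel (α × 𝒰) 𝒲) [IsSFiniteKernel κ]
    (η : Kernel (α × 𝒲) 𝒰) [IsSFiniteKernel η] {m : α × 𝒰 → ℝ} (hm : StronglyMeasurable m)
    (n : ℕ) : StronglyMeasurable (landweber κ η m n) := by
  induction n with
  | zero => exact stronglyMeasurable_const
  | succ n ih =>
    have h1 : StronglyMeasurable fun y : α × 𝒰 =>
        ∫ w, landweber κ η m n (y.1, w) ∂(κ y) :=
      StronglyMeasurable.integral_kernel_prod_right'
        (f := fun y : (α × 𝒰) × 𝒲 => landweber κ η m n (y.1.1, y.2))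
        (ih.comp_measurable (by fun_prop))
    refine ih.add (StronglyMeasurable.integral_kernel_prod_right'
      (f := fun y : (α × 𝒲) × 𝒰 => m (y.1.1, y.2) -
        ∫ w, landweber κ η m n (y.1.1, w) ∂(κ (y.1.1, y.2))) ?_)
    exact (hm.sub h1).comp_measurable
      (by fun_prop : Measurable fun y : (α × 𝒲) × 𝒰 => (y.1.1, y.2))

variable [StandardBorelSpace 𝒲] [Nonempty 𝒲] [StandardBorelSpace 𝒰] [Nonempty 𝒰]
  {Q : Measure (ℝ × 𝒲 × 𝒰)} [IsFiniteMeasure Q]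
  {κ : Kernel (α × 𝒰) 𝒲} {η : Kernel (α × 𝒲) 𝒰} {m : α × 𝒰 → ℝ} {t : α}

/-- On a fibre the Landweber iterates are those of the operator `K` on `L²`. -/
lemma landweber_succ_ae_eq (hr : Regular Q) (hκ : ∀ᵐ u ∂(lawU Q), κ (t, u) = lawWGivenU Q u)
    (hη : ∀ᵐ w ∂(lawW Q), η (t, w) = lawUGivenW Q w)
    (hm : ∀ᵐ u ∂(lawU Q), m (t, u) = outcomeMean Q u) {n : ℕ}
    (hn : MemLp (fun w => landweber κ η m n (t, w)) 2 (lawW Q)) :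
    (fun w => landweber κ η m (n + 1) (t, w)) =ᵐ[lawW Q]
      ⇑(hn.toLp _ + (integralOperator (densityRatio Q) hr.ratio_memLp).adjoint
        (hr.outcome_memLp.toLp (outcomeMean Q) -
          integralOperator (densityRatio Q) hr.ratio_memLp (hn.toLp _))) := by
  -- On the fibre, integration against `κ` acts as `K` and integration against `η` as `K*`, up to
  -- null sets.
  have hres : (fun u => m (t, u) - ∫ w, landweber κ η m n (t, w) ∂(κ (t, u))) =ᵐ[lawU Q]
      outcomeMean Q - kernelIntegral (lawW Q) (densityRatio Q)
        (fun w => landweber κ η m n (t, w)) := by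
    filter_upwards [hκ, hm, integral_lawWGivenU_ae_eq hr.abs_cont hr.ratio_memLp hn]
      with u h1 h2 h3
    rw [h1, h2, h3, Pi.sub_apply]
  have hker := memLp_kernelIntegral hr.ratio_memLp hn
  have hmem := (memLp_congr_ae hres).2 (hr.outcome_memLp.sub hker)
  have hto : hr.outcome_memLp.toLp (outcomeMean Q) -
      integralOperator (densityRatio Q) hr.ratio_memLp (hn.toLp _) = hmem.toLp _ := by
    rw [integralOperator_toLp, ← MemLp.toLp_sub]
    exact MemLp.toLp_congr _ _ hres.symm
  rw [hto, adjoint_integralOperator, integralOperator_toLp]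
  filter_upwards [Lp.coeFn_add (hn.toLp _) ((memLp_kernelIntegral
      (memLp_comp_swap hr.ratio_memLp) hmem).toLp _), hn.coeFn_toLp,
    (memLp_kernelIntegral (memLp_comp_swap hr.ratio_memLp) hmem).coeFn_toLp,
    integral_lawUGivenW_ae_eq hr.abs_cont hr.ratio_memLp hmem, hη] with w h1 h2 h3 h4 h5
  rw [h1, Pi.add_apply, h2, h3, ← h4, ← h5]
  rfl

lemma memLp_landweber (hr : Regular Q) (hκ : ∀ᵐ u ∂(lawU Q), κ (t, u) = lawWGivenU Q u)
    (hη : ∀ᵐ w ∂(lawW Q), η (t, w) = lawUGivenW Q w)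
    (hm : ∀ᵐ u ∂(lawU Q), m (t, u) = outcomeMean Q u) (n : ℕ) :
    MemLp (fun w => landweber κ η m n (t, w)) 2 (lawW Q) := by
  induction n with
  | zero => exact MemLp.zero'
  | succ n ih => exact (memLp_congr_ae (landweber_succ_ae_eq hr hκ hη hm ih)).2 (Lp.memLp _)

/-- On a fibre the averages of the Landweber iterates converge to a solution of
`K g = E(Y | a, ·, x)`. -/
lemma exists_tendsto_landweber (hc : Complete Q) (hr : Regular Q)
    (hκ : ∀ᵐ u ∂(lawU Q), κ (t, u) = lawWGivenU Q u)
    (hη : ∀ᵐ w ∂(lawW Q), η (t, w) = lawUGivenW Q w)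
    (hm : ∀ᵐ u ∂(lawU Q), m (t, u) = outcomeMean Q u) :
    ∃ z : Lp ℝ 2 (lawW Q), integralOperator (densityRatio Q) hr.ratio_memLp z =
        hr.outcome_memLp.toLp (outcomeMean Q) ∧
      Tendsto (fun N : ℕ => eLpNorm (fun w => (N : ℝ)⁻¹ *
        ∑ n ∈ Finset.range N, landweber κ η m n (t, w) - z w) 2 (lawW Q)) atTop (𝓝 0) := by
  have hmem := memLp_landweber hr hκ hη hm
  obtain ⟨z, hz, hlim⟩ := exists_tendsto_landweber_average
    (norm_integralOperator_densityRatio_le hr.abs_cont hr.ratio_memLp)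
    (exists_integralOperator_eq hc hr) (x := fun n => (hmem n).toLp _) (fun n => Lp.ext
      ((hmem (n + 1)).coeFn_toLp.trans (landweber_succ_ae_eq hr hκ hη hm (hmem n))))
  refine ⟨z, hz, ?_⟩
  rw [Lp.tendsto_Lp_iff_tendsto_eLpNorm'] at hlim
  refine hlim.congr fun N => eLpNorm_congr_ae ?_
  have hall : ∀ᵐ w ∂(lawW Q), ∀ n, (hmem n).toLp _ w = landweber κ η m n (t, w) :=
    ae_all_iff.2 fun n => (hmem n).coeFn_toLp
  filter_upwards [hall, Lp.coeFn_smul (N : ℝ)⁻¹ (∑ n ∈ Finset.range N, (hmem n).toLp _),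
    Lp.coeFn_finsetSum (Finset.range N) fun n => (hmem n).toLp _] with w h1 h2 h3
  rw [Pi.sub_apply, h2, Pi.smul_apply, h3, smul_eq_mul]
  simp [h1]

end Landweber


/-! ### From operator solutions to a jointly measurable bridge function. -/

/-- An `L²` solution of `K g = E(Y | a, ·, x)` solves the bridge equation. -/
lemma solvesBridgeEquation_of_integralOperator_eq {𝒲 𝒰 : Type*} [MeasurableSpace 𝒲]
    [StandardBorelSpace 𝒲] [Nonempty 𝒲] [MeasurableSpace 𝒰] {Q : Measure (ℝ × 𝒲 × 𝒰)}
    [IsFiniteMeasure Q] (hr : Regular Q) {z : Lp ℝ 2 (lawW Q)}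
    (hz : integralOperator (densityRatio Q) hr.ratio_memLp z =
      hr.outcome_memLp.toLp (outcomeMean Q)) {g : 𝒲 → ℝ} (hg : g =ᵐ[lawW Q] z) :
    SolvesBridgeEquation Q g where
  memLp := (memLp_congr_ae hg).2 (Lp.memLp z)
  integrable := by
    have hmem : MemLp g 2 (lawW Q) := (memLp_congr_ae hg).2 (Lp.memLp z)
    have hJ : Integrable (fun x : 𝒰 × 𝒲 => g x.2)
        (Q.map fun y : ℝ × 𝒲 × 𝒰 => (y.2.2, y.2.1)) := by
      have h1 : Integrable g ((Q.map fun y : ℝ × 𝒲 × 𝒰 => (y.2.2, y.2.1)).map Prod.snd) := by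
        rw [Measure.map_map measurable_snd (by fun_prop)]
        exact hmem.integrable (by norm_num)
      exact h1.comp_measurable measurable_snd
    exact hJ.condDistrib_ae_map (by fun_prop)
  equation := by
    have hmem : MemLp g 2 (lawW Q) := (memLp_congr_ae hg).2 (Lp.memLp z)
    have h1 := coeFn_integralOperator hr.ratio_memLp z
    rw [hz, ← kernelIntegral_congr hg] at h1
    filter_upwards [h1, hr.outcome_memLp.coeFn_toLp,
      integral_lawWGivenU_ae_eq hr.abs_cont hr.ratio_memLp hmem] with u h2 h3 h4
    rw [h4, ← h2, h3]

/-- Solutions of the bridge equations of the fibres of a Markov kernel can be chosen jointly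
measurable. -/
theorem exists_measurable_solvesBridgeEquation {α 𝒲 𝒰 : Type*} [MeasurableSpace α]
    [MeasurableSpace 𝒲] [StandardBorelSpace 𝒲] [Nonempty 𝒲]
    [MeasurableSpace 𝒰] [StandardBorelSpace 𝒰] [Nonempty 𝒰]
    (F : Kernel α (ℝ × 𝒲 × 𝒰)) [IsMarkovKernel F] :
    ∃ h : α × 𝒲 → ℝ, Measurable h ∧ ∀ t, Complete (F t) → Regular (F t) →
      SolvesBridgeEquation (F t) (fun w => h (t, w)) := by
  have hW : Measurable fun z : ℝ × 𝒲 × 𝒰 => z.2.1 := by fun_prop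
  have hU : Measurable fun z : ℝ × 𝒲 × 𝒰 => z.2.2 := by fun_prop
  let κ : Kernel (α × 𝒰) 𝒲 := (F.map fun z => (z.2.2, z.2.1)).condKernel
  let η : Kernel (α × 𝒲) 𝒰 := (F.map fun z => (z.2.1, z.2.2)).condKernel
  let ρ : Kernel (α × 𝒰) ℝ := (F.map fun z => (z.2.2, z.1)).condKernel
  let m : α × 𝒰 → ℝ := fun x => ∫ y, y ∂(ρ x)
  have hm : StronglyMeasurable m := stronglyMeasurable_id.integral_kernel
  have hmeas : ∀ N : ℕ, Measurable fun x : α × 𝒲 =>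
      (N : ℝ)⁻¹ * ∑ n ∈ Finset.range N, landweber κ η m n x := fun N =>
    (Finset.measurable_fun_sum _ fun n _ =>
      (stronglyMeasurable_landweber κ η hm n).measurable).const_mul _
  obtain ⟨h, hh, hlim⟩ := exists_measurable_fibrewise_limit (F.map fun z => z.2.1) hmeas
  refine ⟨h, hh, fun t hc hr => ?_⟩
  have hκ : ∀ᵐ u ∂(lawU (F t)), κ (t, u) = lawWGivenU (F t) u :=
    condKernel_map_ae_eq_condDistrib F hU hW t
  have hη : ∀ᵐ w ∂(lawW (F t)), η (t, w) = lawUGivenW (F t) w :=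
    condKernel_map_ae_eq_condDistrib F hW hU t
  have hρ : ∀ᵐ u ∂(lawU (F t)), ρ (t, u) = lawYGivenU (F t) u :=
    condKernel_map_ae_eq_condDistrib F hU measurable_fst t
  have hmt : ∀ᵐ u ∂(lawU (F t)), m (t, u) = outcomeMean (F t) u := by
    filter_upwards [hρ] with u hu
    simp only [m, outcomeMean, hu]
  obtain ⟨z, hz, hconv⟩ := exists_tendsto_landweber hc hr hκ hη hmt
  refine solvesBridgeEquation_of_integralOperator_eq hr hz ?_
  have hη' : (F.map fun z => z.2.1) t = lawW (F t) := Kernel.map_apply F hW t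
  have : IsProbabilityMeasure (lawW (F t)) := Measure.isProbabilityMeasure_map hW.aemeasurable
  have hl := hlim t z
  rw [hη'] at hl
  refine hl (Lp.stronglyMeasurable z).measurable.aemeasurable ?_
  -- On a probability space the `L¹` norm is at most the `L²` norm, so `L²` convergence suffices for
  -- the limit theorem.
  refine tendsto_of_tendsto_of_tendsto_of_le_of_le tendsto_const_nhds hconv
    (fun _ => zero_le) fun N => ?_
  dsimp only
  rw [← eLpNorm_one_eq_lintegral_enorm]
  exact eLpNorm_le_eLpNorm_of_exponent_le (by norm_num)
    (((hmeas N).comp measurable_prodMk_left).sub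
      (Lp.stronglyMeasurable z).measurable).aestronglyMeasurable

end ConfoundingBridge

theorem lemma1 {Ω 𝒜 𝒳 𝒲 𝒰 : Type*} [MeasurableSpace Ω] [MeasurableSpace 𝒜] [MeasurableSpace 𝒳]
    [MeasurableSpace 𝒲] [StandardBorelSpace 𝒲] [Nonempty 𝒲]
    [MeasurableSpace 𝒰] [StandardBorelSpace 𝒰] [Nonempty 𝒰]
    (P : Measure Ω) [IsProbabilityMeasure P]
    (Y : Ω → ℝ) (A : Ω → 𝒜) (X : Ω → 𝒳) (W : Ω → 𝒲) (U : Ω → 𝒰) (S : Ω → Fin 2)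
    (hY : Measurable Y) (hA : Measurable A) (hX : Measurable X) (hW : Measurable W)
    (hU : Measurable U) (hS : Measurable S) (hS1 : P {ω | S ω = 1} ≠ 0)
    -- a version of the conditional law of `(Y, W, U)` given `A, X` and `S = 1`
    (F : Kernel (𝒜 × 𝒳) (ℝ × 𝒲 × 𝒰)) [IsMarkovKernel F]
    (hF : HasCondDistrib (fun ω => (Y ω, W ω, U ω)) (fun ω => (A ω, X ω)) F
      (P[|{ω | S ω = 1}]))
    -- the values `(a, x)` under consideration, such as the support of `(A, X)`
    (T : Set (𝒜 × 𝒳))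
    (hcomplete : ∀ t ∈ T, ConfoundingBridge.Complete (F t))
    (hregular : ∀ t ∈ T, ConfoundingBridge.Regular (F t)) :
    ∃ h : 𝒲 → 𝒜 → 𝒳 → ℝ, Measurable (fun z : 𝒲 × 𝒜 × 𝒳 => h z.1 z.2.1 z.2.2) ∧
      ∀ a x, (a, x) ∈ T →
        ConfoundingBridge.SolvesBridgeEquation (F (a, x)) (fun w => h w a x) := by
  obtain ⟨h, hm, hs⟩ := ConfoundingBridge.exists_measurable_solvesBridgeEquation F
  exact ⟨fun w a x => h ((a, x), w), hm.comp (by fun_prop),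
    fun a x hax => hs (a, x) (hcomplete _ hax) (hregular _ hax)⟩
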